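/- **Setting.** An affine manifold is a manifold with an atlas whose transition maps are locally affine; a map is affine if it is affine in affine charts. Let $V=\mathbb R^m$, $W=\mathbb R^l$, let $M_1,M_2$ be compact complete affine manifolds of dimension $m+l$, $B$ an affine manifold of dimension $m$, and let $f_i:M_i\to B$ ($i=1,2$) be affine bundles, i.e. surjective affine maps with connected fibres (all manifolds Hausdorff). An isomorphism $f_1\cong f_2$ is an affine isomorphism $M_1\to M_2$ which covers an affine automorphism of $B$. Choose affine universal coverings $q:V\to B$ and $p_i:V\times W\to M_i$ with $f_i\circ p_i(x,y)=q(x)$. The fundamental group $\pi_1(M_i)$ is the group of affine transformations $\gamma$ of $V\times W$ with $p_i\circ\gamma=p_i$; its elements permute the fibres of $V\times W\to V$. The subgroup $\pi_1(F_i)$ of those preserving each fibre is the fundamental group of the fibres of $f_i$. Let $\mathrm{Aff}(V,W)$ be the group of affine automorphisms of $V\times W$ permuting the fibres of the first projection; write its elements as $$g(x,y)=(A_g x+a_g,\;B_g y+C_g x+d_g),\qquad \bar g(x)=A_gx+a_g .$$ The lifted bundle $\hat f_i$ is $(V\times W)/\pi_1(F_i)\to V$. Assume that the fibres of $f_1$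 and $f_2$ over each point are diffeomorphic and have the same linear holonomy $\gamma\mapsto B_\gamma$, $\gamma\in\pi_1(F_i)$ (up to an isomorphism $\pi_1(F_1)\cong\pi_1(F_2)$ and a linear change of coordinates of $W$), and that $\pi_1(M_1)$ and $\pi_1(M_2)$ are both identified with one group $\pi$. Let $h_i:\pi\to\mathrm{Aff}(V,W)$ be the resulting holonomy representations. For a representation $\rho:\pi\to\mathrm{Aff}(V,W)$, the map $C_\rho:\gamma\mapsto C_{\rho(\gamma)}$ satisfies $C_{\gamma\gamma'}=B_\gamma C_{\gamma'}+C_\gamma A_{\gamma'}$, and $[C_\rho]$ is its class in the first Hochschild cohomology of $\mathbb Z\pi$ with values in $\mathrm{Hom}(V,W)$, with left action by composition with $B_\gamma$ and right action by composition with $A_\gamma$. Further, $[D_\rho]$ is the class of the $1$-cochain $D_\rho:\gamma\mapsto d_{\rho(\gamma)}$ modulo the group $1$-coboundaries $\gamma\mapsto B_\gamma e-e$, $e\in W$ (its class in $H^1(\pi,W)$ whenever it is a cocycle). For $k\in\mathrm{Aff}(V,W)$ and $\theta\in\mathrm{Aut}(\pi)$ put $h_1^{k,\theta}(\gamma)=k\,h_1(\theta^{-1}\gamma)\,k^{-1}$.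 **Theorem.** The following are equivalent. 1. $f_1\cong f_2$. 2. There are $k\in\mathrm{Aff}(V,W)$, a lift to $V\times W$ of an isomorphism $\hat f_1\to\hat f_2$ over a lift to $V$ of an affine automorphism of $B$, and $\theta\in\mathrm{Aut}(\pi)$ inducing on $\pi_1(B)$ and on $\pi_1(F)$ the conjugation by $k$ (that is, $\overline{h_1^{k,\theta}(\gamma)}=\overline{h_2(\gamma)}$ for all $\gamma\in\pi$, and $h_1^{k,\theta}(\gamma)=h_2(\gamma)$ if $h_2(\gamma)\in\pi_1(F_2)$), such that $k$ conjugates the linear holonomy of $M_1$ into that of $M_2$ (that is, $h_1^{k,\theta}(\gamma)$ and $h_2(\gamma)$ have the same linear part for all $\gamma$), and transforms $[C_1]$ into $[C_2]$ and $[D_1]$ into $[D_2]$: $[C_{h_1^{k,\theta}}]=[C_{h_2}]$ and $[D_{h_1^{k,\theta}}]=[D_{h_2}]$. 3. There are such $k$ and $\theta$, where $\theta$ is only required to induce on $\pi_1(B)$ the conjugation by $k$, and $k$ is only required to conjugate the diagonal blocks of the linear holonomies (that is, $h_1^{k,\theta}(\gamma)$ and $h_2(\gamma)$ have the same blocks $A$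 and $B$), with again $[C_{h_1^{k,\theta}}]=[C_{h_2}]$ and $[D_{h_1^{k,\theta}}]=[D_{h_2}]$. -/

import Mathlib

open Set Topology
open scoped Manifold ContDiff

noncomputable section

/-! ### Affine manifolds and affine maps -/

section AffineManifolds

/-- `f` coincides with an affine map near `x` within `s`. -/
def IsAffineWithinAt {E F : Type*} [NormedAddCommGroup E] [NormedSpace ℝ E]
    [NormedAddCommGroup F] [NormedSpace ℝ F] (f : E → F) (s : Set E) (x : E) : Prop :=
  ∃ A : E →ᴬ[ℝ] F, ∀ᶠ y in 𝓝[s] x, f y = A y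

/-- The pregroupoid of locally affine maps. -/
def affinePregroupoid (E : Type*) [NormedAddCommGroup E] [NormedSpace ℝ E] : Pregroupoid E where
  property f s := ∀ x ∈ s, IsAffineWithinAt f s x
  comp := by
    intro f g u v hf hg hu hv huv x hx
    obtain ⟨A, hA⟩ := hf x hx.1
    obtain ⟨A', hA'⟩ := hg (f x) hx.2
    refine ⟨A'.comp A, ?_⟩
    rw [hu.nhdsWithin_eq hx.1] at hA
    rw [hv.nhdsWithin_eq hx.2] at hA'
    rw [huv.nhdsWithin_eq hx]
    have hc : ContinuousAt f x :=
      (A.continuous.continuousAt (x := x)).congr (hA.mono fun y hy => hy.symm)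
    filter_upwards [hA, hc.eventually hA'] with y h1 h2
    simp only [Function.comp_apply, h2]
    simp [h1]
  id_mem := fun x _ => ⟨ContinuousAffineMap.id ℝ E, Filter.Eventually.of_forall fun _ => rfl⟩
  locality := by
    intro f u hu h x hx
    obtain ⟨v, hv, hxv, h'⟩ := h x hx
    obtain ⟨A, hA⟩ := h' x ⟨hx, hxv⟩
    refine ⟨A, ?_⟩
    rw [(hu.inter hv).nhdsWithin_eq ⟨hx, hxv⟩] at hA
    exact hA.filter_mono nhdsWithin_le_nhds
  congr := by
    intro f g u _ hfg hf x hx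
    obtain ⟨A, hA⟩ := hf x hx
    refine ⟨A, ?_⟩
    filter_upwards [hA, self_mem_nhdsWithin] with y h1 h2
    rw [hfg y h2, h1]

/-- The groupoid of locally affine local homeomorphisms of `E`.  An affine manifold modelled on
`E` is a charted space `M` over `E` such that `HasGroupoid M (affineGroupoid E)`. -/
def affineGroupoid (E : Type*) [NormedAddCommGroup E] [NormedSpace ℝ E] : StructureGroupoid E :=
  (affinePregroupoid E).groupoid

variable {E F : Type*} [NormedAddCommGroup E] [NormedSpace ℝ E]
  [NormedAddCommGroup F] [NormedSpace ℝ F]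
  {M N : Type*} [TopologicalSpace M] [ChartedSpace E M] [TopologicalSpace N] [ChartedSpace F N]

/-- A map between affine manifolds is affine if it is continuous and is locally an affine map
when read in affine charts. -/
def IsAffineMap (E F : Type*) [NormedAddCommGroup E] [NormedSpace ℝ E]
    [NormedAddCommGroup F] [NormedSpace ℝ F]
    {M N : Type*} [TopologicalSpace M] [ChartedSpace E M] [TopologicalSpace N] [ChartedSpace F N]
    (f : M → N) : Prop :=
  ChartedSpace.LiftProp (H := E) (H' := F) IsAffineWithinAt f

/-- Affine isomorphisms of affine manifolds. -/
def IsAffineIso (E F : Type*) [NormedAddCommGroup E] [NormedSpace ℝ E]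
    [NormedAddCommGroup F] [NormedSpace ℝ F]
    {M N : Type*} [TopologicalSpace M] [ChartedSpace E M] [TopologicalSpace N] [ChartedSpace F N]
    (e : M ≃ₜ N) : Prop :=
  IsAffineMap E F e ∧ IsAffineMap F E e.symm

/-- An affine universal covering `p : E → M` by the whole model vector space, that is, the
inverse of a bijective developing map followed by the projection of the universal covering.
An affine manifold is complete if and only if it has one. -/
structure IsAffineUniversalCover (p : E → M) : Prop where
  isCoveringMap : IsCoveringMap p
  surjective : Function.Surjective p
  isAffine : IsAffineMap E E p

/-- The deck transformation group of `p`, i.e. the fundamental group of `M` in its (holonomy)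
action on `E` by affine transformations. -/
def deckGroup (p : E → M) : Subgroup (E ≃ᵃ[ℝ] E) where
  carrier := {γ | ∀ z, p (γ z) = p z}
  mul_mem' := by
    intro a b ha hb z
    have h1 : p (a (b z)) = p (b z) := ha (b z)
    exact h1.trans (hb z)
  one_mem' := fun _ => rfl
  inv_mem' := by
    intro a ha z
    have h1 : p (a (a.symm z)) = p (a.symm z) := ha (a.symm z)
    rw [AffineEquiv.apply_symm_apply] at h1
    exact h1.symm

end AffineManifolds

/-! ### Fibre preserving affine transformations of `V × W` -/

section FibreAffine

/-- The group `Aff(V, W)` of the affine automorphisms of `V × W` that permute the fibres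
of the projection `V × W → V`. -/
def fibAff (V W : Type*) [NormedAddCommGroup V] [NormedSpace ℝ V]
    [NormedAddCommGroup W] [NormedSpace ℝ W] : Subgroup ((V × W) ≃ᵃ[ℝ] (V × W)) where
  carrier := {g | ∀ z z', (g z).1 = (g z').1 ↔ z.1 = z'.1}
  mul_mem' := by
    intro a b ha hb z z'
    exact (ha (b z) (b z')).trans (hb z z')
  one_mem' := fun _ _ => Iff.rfl
  inv_mem' := by
    intro a ha z z'
    have h := ha (a.symm z) (a.symm z')
    rw [AffineEquiv.apply_symm_apply, AffineEquiv.apply_symm_apply] at h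
    exact h.symm

variable {V W : Type*} [NormedAddCommGroup V] [NormedSpace ℝ V]
  [NormedAddCommGroup W] [NormedSpace ℝ W]

/-- The affine transformation of `V` induced by `g`: `v ↦ A_g v + a_g`. -/
def basePart (g : (V × W) ≃ᵃ[ℝ] (V × W)) (v : V) : V := (g (v, 0)).1

/-- The block `A_g` of `g (x, y) = (A_g x + a_g, B_g y + C_g x + d_g)`. -/
def blockA (g : (V × W) ≃ᵃ[ℝ] (V × W)) : V →ₗ[ℝ] V :=
  LinearMap.fst ℝ V W ∘ₗ g.linear.toLinearMap ∘ₗ LinearMap.inl ℝ V W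

/-- The block `B_g` of `g (x, y) = (A_g x + a_g, B_g y + C_g x + d_g)`. -/
def blockB (g : (V × W) ≃ᵃ[ℝ] (V × W)) : W →ₗ[ℝ] W :=
  LinearMap.snd ℝ V W ∘ₗ g.linear.toLinearMap ∘ₗ LinearMap.inr ℝ V W

/-- The block `C_g` of `g (x, y) = (A_g x + a_g, B_g y + C_g x + d_g)`. -/
def blockC (g : (V × W) ≃ᵃ[ℝ] (V × W)) : V →ₗ[ℝ] W :=
  LinearMap.snd ℝ V W ∘ₗ g.linear.toLinearMap ∘ₗ LinearMap.inl ℝ V W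

/-- The vector `d_g` of `g (x, y) = (A_g x + a_g, B_g y + C_g x + d_g)`. -/
def vecD (g : (V × W) ≃ᵃ[ℝ] (V × W)) : W := (g 0).2

theorem linear_inr_fst (g : fibAff V W) (y : W) : (g.1.linear (0, y)).1 = 0 := by
  have h := (g.2 (0, y) 0).2 rfl
  have h2 : g.1 (0, y) = g.1.linear (0, y) + g.1 0 := by
    simpa using g.1.map_vadd 0 ((0, y) : V × W)
  rw [h2] at h
  simpa using h

theorem linear_eq_blocks (g : fibAff V W) (z : V × W) :
    g.1.linear z = (blockA g.1 z.1, blockB g.1 z.2 + blockC g.1 z.1) := by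
  have hz : z = (z.1, 0) + (0, z.2) := by simp
  have h0 := linear_inr_fst g z.2
  conv_lhs => rw [hz, map_add]
  ext
  · simp [blockA, h0]
  · simp [blockB, blockC, add_comm]

theorem linear_mul_apply (g h : fibAff V W) (z : V × W) :
    (g * h).1.linear z = g.1.linear (h.1.linear z) := rfl

/-- `g ↦ A_g` as a homomorphism. -/
def homA : fibAff V W →* Module.End ℝ V where
  toFun g := blockA g.1
  map_one' := by ext x; rfl
  map_mul' g h := by
    ext x
    have := congrArg Prod.fst (linear_mul_apply g h (x, 0))
    rw [linear_eq_blocks, linear_eq_blocks, linear_eq_blocks] at this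
    simpa using this

/-- `g ↦ B_g` as a homomorphism. -/
def homB : fibAff V W →* Module.End ℝ W where
  toFun g := blockB g.1
  map_one' := by ext x; rfl
  map_mul' g h := by
    ext y
    have := congrArg Prod.snd (linear_mul_apply g h (0, y))
    rw [linear_eq_blocks, linear_eq_blocks, linear_eq_blocks] at this
    simpa using this

theorem blockC_mul (g h : fibAff V W) :
    blockC (g * h).1 = blockB g.1 ∘ₗ blockC h.1 + blockC g.1 ∘ₗ blockA h.1 := by
  ext x
  have := congrArg Prod.snd (linear_mul_apply g h (x, 0))
  rw [linear_eq_blocks, linear_eq_blocks, linear_eq_blocks] at this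
  simpa using this

end FibreAffine

/-! ### The cohomology classes of a representation in `Aff(V, W)` -/

section Cohomology

variable {G V W : Type*} [Group G] [NormedAddCommGroup V] [NormedSpace ℝ V]
  [NormedAddCommGroup W] [NormedSpace ℝ W]

/-- Hochschild `1`-cocycles of `ℤ[G]` with values in the bimodule `Hom(V, W)`, where `G` acts on
the left by composition with `β` and on the right by composition with `α`.  (A derivation of
`ℤ[G]` is the same as its restriction to `G`.) -/
def hochschildZ1 (α : G →* Module.End ℝ V) (β : G →* Module.End ℝ W) :
    Submodule ℝ (G → (V →ₗ[ℝ] W)) where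
  carrier := {c | ∀ g h, c (g * h) = β g ∘ₗ c h + c g ∘ₗ α h}
  add_mem' := by
    intro c c' hc hc' g h
    simp only [Pi.add_apply, hc g h, hc' g h, LinearMap.comp_add, LinearMap.add_comp]
    abel
  zero_mem' := by intro g h; simp
  smul_mem' := by
    intro r c hc g h
    simp only [Pi.smul_apply, hc g h, LinearMap.comp_smul, LinearMap.smul_comp, smul_add]

/-- The Hochschild differential `E ↦ (g ↦ g·E - E·g)`. -/
def hochschildD0 (α : G →* Module.End ℝ V) (β : G →* Module.End ℝ W) :
    (V →ₗ[ℝ] W) →ₗ[ℝ] hochschildZ1 α β where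
  toFun E := ⟨fun g => β g ∘ₗ E - E ∘ₗ α g, by
    intro g h
    ext x
    simp⟩
  map_add' E E' := by
    ext g x
    simp only [LinearMap.sub_apply, LinearMap.comp_apply, LinearMap.add_apply, map_add,
      Submodule.coe_add, Pi.add_apply]
    abel
  map_smul' r E := by
    ext g x
    simp [smul_sub]

/-- The first Hochschild cohomology group of `ℤ[G]` with values in `Hom(V, W)`. -/
abbrev HochschildH1 (α : G →* Module.End ℝ V) (β : G →* Module.End ℝ W) : Type _ :=
  hochschildZ1 α β ⧸ LinearMap.range (hochschildD0 α β)

/-- The class `[C]` of `g ↦ C_g`, for a representation `ρ : G → Aff(V, W)` whose diagonal linear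
blocks are `α` and `β`. -/
def classC (α : G →* Module.End ℝ V) (β : G →* Module.End ℝ W) (ρ : G →* fibAff V W)
    (hα : homA.comp ρ = α) (hβ : homB.comp ρ = β) : HochschildH1 α β :=
  Submodule.Quotient.mk ⟨fun g => blockC (ρ g).1, by
    intro g h
    subst hα hβ
    simp only [map_mul]
    exact blockC_mul (ρ g) (ρ h)⟩

/-- The group cohomology differential `e ↦ (g ↦ g·e - e)` on `1`-cochains. -/
def groupD0 (β : G →* Module.End ℝ W) : W →ₗ[ℝ] (G → W) where
  toFun e := fun g => β g e - e
  map_add' e e' := by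
    funext g
    simp only [map_add, Pi.add_apply]
    abel
  map_smul' r e := by
    funext g
    simp [smul_sub]

/-- The class `[D]` of the `1`-cochain `g ↦ d_g` modulo the group `1`-coboundaries
`g ↦ β g e - e`.  (If the cochain is a cocycle, this is its class in `H¹(G, W)`.) -/
def classD (β : G →* Module.End ℝ W) (ρ : G →* fibAff V W) :
    (G → W) ⧸ LinearMap.range (groupD0 β) :=
  Submodule.Quotient.mk fun g => vecD (ρ g).1

/-- `ρ'` and `ρ` have the same diagonal linear blocks, `[C_ρ'] = [C_ρ]` and `[D_ρ'] = [D_ρ]`. -/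
def SameClasses (ρ' ρ : G →* fibAff V W) : Prop :=
  ∃ (hA : homA.comp ρ' = homA.comp ρ) (hB : homB.comp ρ' = homB.comp ρ),
    classC (homA.comp ρ) (homB.comp ρ) ρ' hA hB = classC (homA.comp ρ) (homB.comp ρ) ρ rfl rfl ∧
    classD (homB.comp ρ) ρ' = classD (homB.comp ρ) ρ

/-- The representation `γ ↦ k ρ(θ⁻¹ γ) k⁻¹`: the transform of `ρ` by `k`, when `θ` identifies
the group acting before with the group acting after. -/
def conjRep (k : fibAff V W) (θ : G ≃* G) (ρ : G →* fibAff V W) : G →* fibAff V W :=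
  (MulAut.conj k).toMonoidHom.comp (ρ.comp θ.symm.toMonoidHom)

end Cohomology

/-! ### Affine bundles -/

section Bundles

variable {V W : Type*} [NormedAddCommGroup V] [NormedSpace ℝ V]
  [NormedAddCommGroup W] [NormedSpace ℝ W]
  {B M M₁ M₂ : Type*} [TopologicalSpace B] [ChartedSpace V B]
  [TopologicalSpace M] [ChartedSpace (V × W) M]
  [TopologicalSpace M₁] [ChartedSpace (V × W) M₁]
  [TopologicalSpace M₂] [ChartedSpace (V × W) M₂]

/-- Affine bundles: surjective affine maps (with connected fibres). -/
structure IsAffineBundle (V W : Type*) [NormedAddCommGroup V] [NormedSpace ℝ V]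
    [NormedAddCommGroup W] [NormedSpace ℝ W] {B M : Type*} [TopologicalSpace B] [ChartedSpace V B]
    [TopologicalSpace M] [ChartedSpace (V × W) M] (f : M → B) : Prop where
  isAffine : IsAffineMap (V × W) V f
  surjective : Function.Surjective f
  isConnected_fibre : ∀ b, IsConnected (f ⁻¹' {b})

/-- Isomorphism of affine bundles over `B`: an affine isomorphism of the total spaces that
projects to an affine automorphism of `B`. -/
def AffineBundleIso (V W : Type*) [NormedAddCommGroup V] [NormedSpace ℝ V]
    [NormedAddCommGroup W] [NormedSpace ℝ W]
    {B M₁ M₂ : Type*} [TopologicalSpace B] [ChartedSpace V B]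
    [TopologicalSpace M₁] [ChartedSpace (V × W) M₁]
    [TopologicalSpace M₂] [ChartedSpace (V × W) M₂] (f₁ : M₁ → B) (f₂ : M₂ → B) : Prop :=
  ∃ (Φ : M₁ ≃ₜ M₂) (φ : B ≃ₜ B), IsAffineIso (V × W) (V × W) Φ ∧ IsAffineIso V V φ ∧
    ∀ x, f₂ (Φ x) = φ (f₁ x)

/-- Coordinates adapted to the affine bundle `f : M → B`: affine universal coverings
`p : V × W → M` and `q : V → B` such that `f` lifts to the first projection. -/
structure IsAdaptedCover (f : M → B) (q : V → B) (p : V × W → M) : Prop where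
  base : IsAffineUniversalCover q
  total : IsAffineUniversalCover p
  comm : ∀ z, f (p z) = q z.1

theorem IsAdaptedCover.fst_deck [FiniteDimensional ℝ V] [FiniteDimensional ℝ W]
    {f : M → B} {q : V → B} {p : V × W → M} (h : IsAdaptedCover f q p)
    {γ : (V × W) ≃ᵃ[ℝ] (V × W)} (hγ : γ ∈ deckGroup p) (z z' : V × W) (hz : z.1 = z'.1) :
    (γ z).1 = (γ z').1 := by
  have hc : Continuous γ := γ.toAffineMap.continuous_of_finiteDimensional
  have h1 : Continuous fun w : W => (γ (z.1, w)).1 := by fun_prop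
  have h2 : (q ∘ fun w : W => (γ (z.1, w)).1) = q ∘ fun _ : W => (γ (z.1, z.2)).1 := by
    funext w
    simp only [Function.comp_apply]
    rw [← h.comm, ← h.comm, hγ, hγ, h.comm, h.comm]
  have h3 := h.base.isCoveringMap.eq_of_comp_eq h1 continuous_const h2 z.2 rfl
  have h4 := congrFun h3 z'.2
  rw [hz] at h4
  rw [show z = (z'.1, z.2) from Prod.ext hz rfl]
  exact h4.symm

theorem IsAdaptedCover.deckGroup_le [FiniteDimensional ℝ V] [FiniteDimensional ℝ W]
    {f : M → B} {q : V → B} {p : V × W → M} (h : IsAdaptedCover f q p) :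
    deckGroup p ≤ fibAff V W := by
  intro γ hγ z z'
  refine ⟨fun hz => ?_, h.fst_deck hγ z z'⟩
  have h1 := h.fst_deck (inv_mem hγ) (γ z) (γ z') hz
  have e : ∀ y, (γ⁻¹ : (V × W) ≃ᵃ[ℝ] (V × W)) (γ y) = y := fun y => γ.symm_apply_apply y
  rwa [e, e] at h1

/-- The holonomy representation in `Aff(V, W)` of a group `G` identified with the fundamental
group of the total space. -/
def IsAdaptedCover.holonomy [FiniteDimensional ℝ V] [FiniteDimensional ℝ W] {G : Type*} [Group G]
    {f : M → B} {q : V → B} {p : V × W → M} (h : IsAdaptedCover f q p) (ι : G ≃* deckGroup p) :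
    G →* fibAff V W :=
  (Subgroup.inclusion h.deckGroup_le).comp ι.toMonoidHom

/-- The fundamental group of the fibres: the deck transformations of the total space that
preserve each fibre of `V × W → V`. -/
def fibreGroup (p : V × W → M) : Subgroup ((V × W) ≃ᵃ[ℝ] (V × W)) where
  carrier := {γ | γ ∈ deckGroup p ∧ ∀ z, (γ z).1 = z.1}
  mul_mem' := by
    intro a b ha hb
    refine ⟨mul_mem ha.1 hb.1, fun z => ?_⟩
    have h1 : (a (b z)).1 = (b z).1 := ha.2 (b z)
    exact h1.trans (hb.2 z)
  one_mem' := ⟨one_mem _, fun _ => rfl⟩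
  inv_mem' := by
    intro a ha
    refine ⟨inv_mem ha.1, fun z => ?_⟩
    have h1 := ha.2 (a.symm z)
    rw [AffineEquiv.apply_symm_apply] at h1
    exact h1.symm

/-- The orbit relation of the fundamental group of the fibres on `V × W`. -/
def fibreSetoid (p : V × W → M) : Setoid (V × W) where
  r z z' := ∃ γ ∈ fibreGroup p, γ z = z'
  iseqv :=
    { refl := fun _ => ⟨1, one_mem _, rfl⟩
      symm := by
        rintro z z' ⟨γ, hγ, rfl⟩
        exact ⟨γ⁻¹, inv_mem hγ, γ.symm_apply_apply z⟩
      trans := by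
        rintro z z' z'' ⟨γ, hγ, rfl⟩ ⟨δ, hδ, rfl⟩
        exact ⟨δ * γ, mul_mem hδ hγ, rfl⟩ }

/-- The total space `(V × W) / π₁(F)` of the lifted bundle `f̂`; the projection of `f̂` onto `V` is
induced by the first projection. -/
abbrev LiftedTotal (p : V × W → M) : Type _ := Quotient (fibreSetoid p)

/-- `k` is a lift to `V × W` of an isomorphism `f̂₁ ≅ f̂₂` over an automorphism of `B`.  (The
homeomorphism of the total spaces is affine because its lift `k` is.) -/
def LiftsIsoOverAut (q : V → B) (p₁ : V × W → M₁) (p₂ : V × W → M₂) (k : fibAff V W) : Prop :=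
  (∃ Ψ : LiftedTotal p₁ ≃ₜ LiftedTotal p₂,
    ∀ z : V × W, Ψ (Quotient.mk (fibreSetoid p₁) z) = Quotient.mk (fibreSetoid p₂) (k.1 z)) ∧
  (∃ φ : B ≃ₜ B, IsAffineIso V V φ ∧ ∀ v : V, q (basePart k.1 v) = φ (q v))

/-- The fibres of `f₁` and `f₂` over each point are diffeomorphic. -/
def DiffeomorphicFibres (V W : Type*) [NormedAddCommGroup V] [NormedSpace ℝ V]
    [NormedAddCommGroup W] [NormedSpace ℝ W]
    {B M₁ M₂ : Type*} [TopologicalSpace M₁] [ChartedSpace (V × W) M₁]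
    [TopologicalSpace M₂] [ChartedSpace (V × W) M₂] (f₁ : M₁ → B) (f₂ : M₂ → B) : Prop :=
  ∀ b : B, ∃ (g : M₁ → M₂) (g' : M₂ → M₁),
    MapsTo g (f₁ ⁻¹' {b}) (f₂ ⁻¹' {b}) ∧ MapsTo g' (f₂ ⁻¹' {b}) (f₁ ⁻¹' {b}) ∧
    InvOn g' g (f₁ ⁻¹' {b}) (f₂ ⁻¹' {b}) ∧
    ContMDiffOn 𝓘(ℝ, V × W) 𝓘(ℝ, V × W) ∞ g (f₁ ⁻¹' {b}) ∧
    ContMDiffOn 𝓘(ℝ, V × W) 𝓘(ℝ, V × W) ∞ g' (f₂ ⁻¹' {b})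

/-- The fibres have the same linear holonomy, up to an identification of their fundamental groups
and a linear change of coordinates in `W`. -/
def SameFibreLinearHolonomy (p₁ : V × W → M₁) (p₂ : V × W → M₂) : Prop :=
  ∃ (τ : fibreGroup p₁ ≃* fibreGroup p₂) (b : W ≃ₗ[ℝ] W), ∀ (γ : fibreGroup p₁) (y : W),
    b (blockB γ.1 y) = blockB (τ γ).1 (b y)

end Bundles

end

/-! An isomorphism lifts to some `k` in `Aff(V, W)` conjugating the deck groups. With `θ` the
induced automorphism of `π`, the transformed representation equals `h₂`, so 1 implies 2, and 2
contains 3.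

The content is 3 implies 1. Let `ρ'` be the transform of `h₁` and `ρ = h₂`. They share the blocks A,
B and the action on V, and equality of the classes [D] gives `e` with d' = d + B e - e. Substituting
this in the product rule d(γδ) = B(γ) d(δ) + C(γ) a(δ) + d(γ), valid for both, leaves C'(γ) a(δ) =
C(γ) a(δ) for all γ, δ. If the vectors a(δ) span V, then C' = C, and translating the fibres by `e`
conjugates `ρ'` into `ρ`. The translation composed with `k` then descends to the bundle isomorphism.

Spanning comes from compactness: the orbit of 0 under the deck group Γ of a compact complete affine
manifold lies in no proper subspace T. Choose a C¹ map f with f(x) in the convex hull of those γ0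
for which γ carries a fixed ball D over x. It has values in T. Since Γ acts by affine maps, properly
and cocompactly, each value is attained only on a bounded set along the straight homotopy from the
identity to f. Hence f is onto (`exists_eq_of_isBounded_homotopy`) and T is everything. Surjectivity
rests on the no-retraction theorem, proved by the analytic argument that a volume is polynomial in
time. -/

noncomputable section

/-! ### Determinants of `1 + tA` as polynomials in `t` -/

section NoRetraction

open MeasureTheory

theorem exists_polynomial_eval_eq_det_one_add_smul {E : Type*} [AddCommGroup E] [Module ℝ E]
    [FiniteDimensional ℝ E] (A : E →ₗ[ℝ] E) :
    ∃ P : Polynomial ℝ, P.natDegree ≤ Module.finrank ℝ E ∧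
      ∀ t : ℝ, P.eval t = LinearMap.det (1 + t • A) := by
  let b := Module.finBasis ℝ E
  let M := LinearMap.toMatrix b b A
  refine ⟨((Polynomial.X : Polynomial ℝ) • M.map Polynomial.C +
    (1 : Matrix (Fin (Module.finrank ℝ E)) (Fin (Module.finrank ℝ E)) ℝ).map
      Polynomial.C).det, ?_, fun t => ?_⟩
  · simpa using Polynomial.natDegree_det_X_add_C_le M 1
  · rw [← LinearMap.det_toMatrix b, ← Polynomial.coe_evalRingHom, RingHom.map_det]
    congr 1
    ext i j
    by_cases h : i = j <;> simp [M, LinearMap.toMatrix_one, h, add_comm, mul_comm t]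

variable {E : Type*} [NormedAddCommGroup E] [NormedSpace ℝ E] [FiniteDimensional ℝ E]

theorem det_one_add_pos_of_norm_lt_one (A : E →L[ℝ] E) (hA : ‖A‖ < 1) : 0 < (1 + A).det := by
  by_contra hneg
  push Not at hneg
  have hc : ContinuousOn (fun s : ℝ => (1 + s • A).det) (Icc 0 1) :=
    (ContinuousLinearMap.continuous_det.comp (by fun_prop)).continuousOn
  -- The determinant is 1 at `s = 0` and cannot vanish on [0, 1], because `1 + sA` stays invertible
  -- by the Neumann series.
  have h0 : (fun s : ℝ => (1 + s • A).det) 0 = 1 := by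
    simp [ContinuousLinearMap.det]
  obtain ⟨s, hs, hs0⟩ := intermediate_value_Icc' (zero_le_one' ℝ) hc
    (show (0 : ℝ) ∈ _ from ⟨by simpa using hneg, zero_le_one.trans_eq h0.symm⟩)
  have hlt : ‖-(s • A)‖ < 1 := by
    rw [norm_neg, norm_smul, Real.norm_of_nonneg hs.1]
    nlinarith [hs.2, norm_nonneg A, hs.1]
  have hu := isUnit_one_sub_of_norm_lt_one hlt
  rw [sub_neg_eq_add] at hu
  have h2 : IsUnit ((1 + s • A : E →L[ℝ] E) : E →ₗ[ℝ] E) :=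
    hu.map (ContinuousLinearMap.toLinearMapRingHom : (E →L[ℝ] E) →+* (E →ₗ[ℝ] E))
  have h3 := h2.map LinearMap.det
  exact h3.ne_zero hs0

/-- The integral of a polynomial family is determined by its values at small times. -/
theorem integral_det_one_add_eq_of_small [MeasurableSpace E] [BorelSpace E] {μ : Measure E}
    {s : Set E} {U : E → E →L[ℝ] E} {δ c : ℝ} (hδ : 0 < δ)
    (hint : ∀ t : ℝ, IntegrableOn (fun x => (1 + t • U x).det) s μ)
    (hsmall : ∀ t : ℝ, 0 < t → t < δ → ∫ x in s, (1 + t • U x).det ∂μ = c) :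
    ∫ x in s, (1 + (1 : ℝ) • U x).det ∂μ = c := by
  classical
  set n := Module.finrank ℝ E
  let S := Finset.range (n + 1)
  -- These are n + 1 distinct nodes in (0, δ); the shift by 2 keeps even the node with `i = 0`
  -- strictly below δ.
  let v : ℕ → ℝ := fun i => δ / (i + 2)
  have hv0 : ∀ i, 0 < v i := fun i => by positivity
  have hv1 : ∀ i, v i < δ := fun i => by
    rw [div_lt_iff₀ (by positivity)]
    nlinarith [(Nat.cast_nonneg i : (0 : ℝ) ≤ i)]
  have hinj : Set.InjOn v S := by
    intro i _ j _ hij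
    have h1 : (i : ℝ) + 2 = j + 2 := by
      have h : δ / ((i : ℝ) + 2) = δ / (j + 2) := hij
      have hi : (i : ℝ) + 2 ≠ 0 := by positivity
      have hj : (j : ℝ) + 2 ≠ 0 := by positivity
      field_simp at h
      linarith
    exact_mod_cast (add_right_cancel h1)
  -- Lagrange weights: the value at 1 of a polynomial of degree at most n is a fixed combination of
  -- its values at the nodes, so this passes through the integral.
  let w : ℕ → ℝ := fun i => (Lagrange.basis S v i).eval 1
  have key : ∀ f : Polynomial ℝ, f.natDegree ≤ n → f.eval 1 = ∑ i ∈ S, f.eval (v i) * w i := by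
    intro f hf
    have hdeg : f.degree < (S.card : ℕ) := by
      refine lt_of_le_of_lt Polynomial.degree_le_natDegree ?_
      simp only [S, Finset.card_range]
      exact_mod_cast Nat.lt_succ_of_le hf
    have h := Lagrange.eq_interpolate_of_eval_eq (fun i => f.eval (v i)) hinj hdeg
      (fun _ _ => rfl)
    conv_lhs => rw [h]
    simp [Lagrange.interpolate_apply, Polynomial.eval_finsetSum, w]
  have hpt : ∀ x, (1 + (1 : ℝ) • U x).det = ∑ i ∈ S, (1 + v i • U x).det * w i := by
    intro x
    obtain ⟨P, hP, hPe⟩ := exists_polynomial_eval_eq_det_one_add_smul (U x : E →ₗ[ℝ] E)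
    have h := key P hP
    simp only [hPe] at h
    exact h
  have hone : ∑ i ∈ S, w i = 1 := by
    have h := key 1 (by simp)
    simpa using h.symm
  simp only [hpt]
  rw [integral_finsetSum _ fun i _ => (hint (v i)).mul_const _]
  simp only [integral_mul_const, hsmall _ (hv0 _) (hv1 _)]
  rw [← Finset.mul_sum, hone, mul_one]

end NoRetraction

/-! ### The no-retraction theorem and surjectivity by homotopy -/

section NoRetractionInner

open MeasureTheory Metric

variable {E : Type*} [NormedAddCommGroup E] [InnerProductSpace ℝ E] [FiniteDimensional ℝ E]

/-- The interpolation between the identity and a `C¹` map of the closed unit ball which is the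
identity on the sphere is, for small times, a bijection of the open unit ball. -/
theorem bijOn_ball_of_small {g : E → E} (hg : ContDiff ℝ 1 g)
    (hmaps : ∀ x ∈ closedBall (0 : E) 1, ‖g x‖ ≤ 1) (hid : ∀ x : E, ‖x‖ = 1 → g x = x)
    {C t : ℝ} (hC : ∀ x ∈ closedBall (0 : E) 1, ‖fderiv ℝ g x - 1‖ ≤ C) (ht : 0 < t) (ht1 : t < 1)
    (htC : t * C < 1) :
    BijOn (fun x => x + t • (g x - x)) (ball 0 1) (ball 0 1) := by
  set φ : E → E := fun x => x + t • (g x - x) with hφ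
  have hφc : ContDiff ℝ 1 φ := by fun_prop
  have hgd : ∀ x, HasFDerivAt g (fderiv ℝ g x) x := fun x =>
    (hg.differentiable one_ne_zero x).hasFDerivAt
  have hφd : ∀ x, HasFDerivAt φ (1 + t • (fderiv ℝ g x - 1)) x := fun x =>
    (hasFDerivAt_id x).add (((hgd x).sub (hasFDerivAt_id x)).const_smul t)
  have hmap : MapsTo φ (ball 0 1) (ball 0 1) := by
    intro x hx
    rw [mem_ball_zero_iff] at hx ⊢
    have h1 := hmaps x (by rw [mem_closedBall_zero_iff]; exact hx.le)
    calc ‖φ x‖ = ‖(1 - t) • x + t • g x‖ := by rw [hφ]; congr 1; module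
      _ ≤ ‖(1 - t) • x‖ + ‖t • g x‖ := norm_add_le _ _
      _ = (1 - t) * ‖x‖ + t * ‖g x‖ := by
        rw [norm_smul, norm_smul, Real.norm_of_nonneg ht.le, Real.norm_of_nonneg (by linarith)]
      _ < 1 := by nlinarith
  -- The perturbation `t • (g - id)` has Lipschitz constant at most `tC < 1` on the ball.
  have hinj : InjOn φ (closedBall 0 1) := by
    intro x hx y hy hxy
    have h1 := Convex.norm_image_sub_le_of_norm_hasFDerivWithin_le
      (fun z _ => ((hgd z).sub (hasFDerivAt_id z)).hasFDerivWithinAt) hC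
      (convex_closedBall (0 : E) 1) hx hy
    have h2 : x - y = t • ((g y - y) - (g x - x)) := by
      have : x + t • (g x - x) = y + t • (g y - y) := hxy
      rw [smul_sub, sub_eq_sub_iff_add_eq_add, this]; abel
    have h3 : ‖y - x‖ ≤ t * (C * ‖y - x‖) := by
      conv_lhs => rw [norm_sub_rev, h2, norm_smul, Real.norm_of_nonneg ht.le]
      exact mul_le_mul_of_nonneg_left h1 ht.le
    have h4 : ‖y - x‖ = 0 := by
      by_contra hne
      have : 0 < ‖y - x‖ := lt_of_le_of_ne (norm_nonneg _) (Ne.symm hne)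
      nlinarith
    exact (sub_eq_zero.1 (norm_eq_zero.1 h4)).symm
  refine ⟨hmap, hinj.mono ball_subset_closedBall, ?_⟩
  -- The derivative of `φ` is invertible, so the inverse function theorem applies. Surjectivity then
  -- follows by connectedness: the image is open, and also closed relative to the ball since sphere
  -- points are fixed.
  have hopen : IsOpen (φ '' ball 0 1) := by
    rw [isOpen_iff_mem_nhds]
    rintro _ ⟨x, hx, rfl⟩
    have hlt : ‖-(t • (fderiv ℝ g x - 1))‖ < 1 := by
      rw [norm_neg, norm_smul, Real.norm_of_nonneg ht.le]
      have := hC x (ball_subset_closedBall hx)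
      nlinarith
    have hu := isUnit_one_sub_of_norm_lt_one hlt
    rw [sub_neg_eq_add] at hu
    have h2 : IsUnit ((1 + t • (fderiv ℝ g x - 1) : E →L[ℝ] E) : E →ₗ[ℝ] E) :=
      hu.map (ContinuousLinearMap.toLinearMapRingHom : (E →L[ℝ] E) →+* (E →ₗ[ℝ] E))
    have hs : HasStrictFDerivAt φ (1 + t • (fderiv ℝ g x - 1)) x :=
      hφc.contDiffAt.hasStrictFDerivAt' (hφd x) one_ne_zero
    rw [← hs.map_nhds_eq_of_surj ((LinearMap.isUnit_iff_range_eq_top _).1 h2)]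
    exact Filter.image_mem_map (isOpen_ball.mem_nhds hx)
  refine (convex_ball (0 : E) 1).isPreconnected.subset_of_closure_inter_subset hopen
    ⟨φ 0, hmap (mem_ball_self one_pos), mem_image_of_mem _ (mem_ball_self one_pos)⟩ ?_
  rintro y ⟨hy, hyb⟩
  have hcl : IsClosed (φ '' closedBall 0 1) :=
    ((isCompact_closedBall (0 : E) 1).image hφc.continuous).isClosed
  obtain ⟨x, hx, rfl⟩ := closure_minimal (image_mono ball_subset_closedBall) hcl hy
  rcases (mem_closedBall_zero_iff.1 hx).lt_or_eq with h | h
  · exact mem_image_of_mem _ (mem_ball_zero_iff.2 h)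
  · have : φ x = x := by simp [hφ, hid x h]
    rw [this, mem_ball_zero_iff] at hyb
    exact absurd h hyb.ne

/-- There is no `C¹` retraction of the unit ball onto the unit sphere. -/
theorem not_exists_retraction_sphere {g : E → E} (hg : ContDiff ℝ 1 g)
    (hmaps : ∀ x ∈ closedBall (0 : E) 1, ‖g x‖ = 1) (hid : ∀ x : E, ‖x‖ = 1 → g x = x) :
    False := by
  let _ : MeasurableSpace E := borel E
  have : BorelSpace E := ⟨rfl⟩
  have hcont : Continuous fun x => fderiv ℝ g x - 1 :=
    (hg.continuous_fderiv one_ne_zero).sub continuous_const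
  have hgd : ∀ x, HasFDerivAt g (fderiv ℝ g x) x := fun x =>
    (hg.differentiable one_ne_zero x).hasFDerivAt
  obtain ⟨C, hC⟩ := (isCompact_closedBall (0 : E) 1).exists_bound_of_continuousOn
    hcont.continuousOn
  have hC0 : 0 ≤ C := (norm_nonneg _).trans (hC 0 (mem_closedBall_self zero_le_one))
  have hint : ∀ t : ℝ, IntegrableOn (fun x => (1 + t • (fderiv ℝ g x - 1)).det) (ball 0 1)
      (volume : Measure E) := by
    intro t
    have h : Continuous fun x => (1 + t • (fderiv ℝ g x - 1)).det :=
      ContinuousLinearMap.continuous_det.comp (continuous_const.add (hcont.const_smul t))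
    exact (h.continuousOn.integrableOn_compact (isCompact_closedBall (0 : E) 1)).mono_set
      ball_subset_closedBall
  -- The bound `t (C + 1) < 1` gives both `t < 1` and `t C < 1`. The integral is then the volume of
  -- the image, which is the ball itself.
  have hsmall : ∀ t : ℝ, 0 < t → t < 1 / (C + 1) →
      ∫ x in ball (0 : E) 1, (1 + t • (fderiv ℝ g x - 1)).det = volume.real (ball (0 : E) 1) := by
    intro t ht htlt
    rw [lt_div_iff₀ (by positivity)] at htlt
    have hb := bijOn_ball_of_small hg (fun x hx => (hmaps x hx).le) hid hC ht
      (by nlinarith) (by nlinarith)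
    have h := integral_image_eq_integral_abs_det_fderiv_smul (volume : Measure E)
      measurableSet_ball (fun x _ => ((hasFDerivAt_id x).add
        (((hgd x).sub (hasFDerivAt_id x)).const_smul t)).hasFDerivWithinAt) hb.injOn
      (fun _ => (1 : ℝ))
    rw [show (id + t • (g - id)) '' ball (0 : E) 1 = ball 0 1 from hb.image_eq] at h
    rw [setIntegral_const, smul_eq_mul, mul_one] at h
    rw [h]
    refine setIntegral_congr_fun measurableSet_ball fun x hx => ?_
    have hpos : 0 < (1 + t • (fderiv ℝ g x - 1)).det := by
      apply det_one_add_pos_of_norm_lt_one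
      rw [norm_smul, Real.norm_of_nonneg ht.le]
      have := hC x (ball_subset_closedBall hx)
      nlinarith
    simp only [smul_eq_mul, mul_one]
    exact (abs_of_pos hpos).symm
  have hone := integral_det_one_add_eq_of_small (by positivity) hint hsmall
  -- At time 1 the integrand is det Dg. As |g|² = 1, the range of Dg is orthogonal to g(x) ≠ 0, so
  -- Dg is singular.
  have hzero : ∫ x in ball (0 : E) 1, (1 + (1 : ℝ) • (fderiv ℝ g x - 1)).det = 0 := by
    rw [← integral_zero (α := E) (G := ℝ) (μ := volume.restrict (ball 0 1))]
    refine setIntegral_congr_fun measurableSet_ball fun x hx => ?_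
    simp only [one_smul, add_sub_cancel]
    by_contra hne
    have hu : IsUnit (LinearMap.det (fderiv ℝ g x : E →ₗ[ℝ] E)) := isUnit_iff_ne_zero.2 hne
    have hr := (LinearMap.isUnit_iff_range_eq_top _).1 ((LinearMap.isUnit_iff_isUnit_det _).2 hu)
    obtain ⟨v, hv⟩ : g x ∈ LinearMap.range (fderiv ℝ g x : E →ₗ[ℝ] E) := hr ▸ Submodule.mem_top
    have hd : HasFDerivAt (fun y => inner ℝ (g y) (g y)) _ x := (hgd x).inner ℝ (hgd x)
    have hev : (fun y => inner ℝ (g y) (g y)) =ᶠ[𝓝 x] fun _ => (1 : ℝ) := by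
      filter_upwards [isOpen_ball.mem_nhds hx] with y hy
      rw [real_inner_self_eq_norm_sq, hmaps y (ball_subset_closedBall hy), one_pow]
    have h0 := hd.unique ((hasFDerivAt_const (1 : ℝ) x).congr_of_eventuallyEq hev)
    have h1 := congrArg (fun L : E →L[ℝ] ℝ => L v) h0
    have hv' : fderiv ℝ g x v = g x := hv
    simp [fderivInnerCLM_apply, hv', hmaps x (ball_subset_closedBall hx)] at h1
  rw [hzero] at hone
  exact (ENNReal.toReal_pos (measure_ball_pos volume (0 : E) one_pos).ne'
    measure_ball_lt_top.ne).ne hone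

/-- Without a zero, normalising `F (R • x)` would retract the unit ball onto the sphere. -/
theorem exists_eq_zero_of_eq_id_of_norm_ge {F : E → E} (hF : ContDiff ℝ 1 F) {R : ℝ} (hR : 0 < R)
    (hid : ∀ x, R ≤ ‖x‖ → F x = x) : ∃ x, F x = 0 := by
  by_contra! hne
  have hs : ContDiff ℝ 1 fun x : E => F (R • x) := hF.comp (by fun_prop)
  refine not_exists_retraction_sphere (g := fun x => ‖F (R • x)‖⁻¹ • F (R • x))
    (((hs.norm ℝ fun x => hne _).inv fun x => norm_ne_zero_iff.2 (hne _)).smul hs) ?_ ?_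
  · intro x _
    rw [norm_smul, norm_inv, norm_norm, inv_mul_cancel₀ (norm_ne_zero_iff.2 (hne _))]
  · intro x hx
    have h1 : ‖R • x‖ = R := by rw [norm_smul, hx, mul_one, Real.norm_of_nonneg hR.le]
    simp only [hid _ h1.ge, h1, smul_smul]
    rw [inv_mul_cancel₀ hR.ne', one_smul]

/-- With a bump function as the time parameter, the homotopy becomes the identity far away and `f`
on the ball containing all its zeros. A zero of the cut-off map is a zero of the homotopy at time `χ
x`, so it lies where `χ = 1`. -/
theorem exists_eq_zero_of_isBounded_homotopy {f : E → E} (hf : ContDiff ℝ 1 f)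
    (hb : Bornology.IsBounded {x | ∃ t ∈ Icc (0 : ℝ) 1, (1 - t) • x + t • f x = 0}) :
    ∃ x, f x = 0 := by
  obtain ⟨R, hR, hsub⟩ := hb.subset_ball_lt 0 0
  let χ : ContDiffBump (0 : E) := ⟨R, R + 1, hR, by linarith⟩
  have hχ : ContDiff ℝ 1 (χ : E → ℝ) := χ.contDiff
  obtain ⟨x, hx⟩ := exists_eq_zero_of_eq_id_of_norm_ge
    (F := fun x => (1 - χ x) • x + χ x • f x) (by fun_prop) (R := R + 1) (by linarith)
    fun x hx => by
      have : χ x = 0 := χ.zero_of_le_dist (by simpa [χ] using hx)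
      simp [this]
  have hxR : x ∈ ball 0 R := hsub ⟨χ x, ⟨χ.nonneg, χ.le_one⟩, hx⟩
  have h1 : χ x = 1 := χ.one_of_mem_closedBall (ball_subset_closedBall hxR)
  exact ⟨x, by simpa [h1] using hx⟩

end NoRetractionInner

/-- A `C¹` map is onto a point if its straight line homotopy to the identity hits this point
only at a bounded set of arguments. -/
theorem exists_eq_of_isBounded_homotopy {E : Type*} [NormedAddCommGroup E] [NormedSpace ℝ E]
    [FiniteDimensional ℝ E] {f : E → E} (hf : ContDiff ℝ 1 f) (p : E)
    (hb : Bornology.IsBounded {x | ∃ t ∈ Icc (0 : ℝ) 1, (1 - t) • x + t • f x = p}) :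
    ∃ x, f x = p := by
  let L : E ≃L[ℝ] EuclideanSpace ℝ (Fin (Module.finrank ℝ E)) := toEuclidean
  obtain ⟨y, hy⟩ := exists_eq_zero_of_isBounded_homotopy (f := fun y => L (f (L.symm y + p) - p))
    (by
      have := L.symm.contDiff (n := 1)
      have := L.contDiff (n := 1)
      fun_prop)
    (by
      have h1 : Bornology.IsBounded ((fun x => L (x - p)) ''
          {x | ∃ t ∈ Icc (0 : ℝ) 1, (1 - t) • x + t • f x = p}) := by
        have hc : IsCompact (closure {x | ∃ t ∈ Icc (0 : ℝ) 1, (1 - t) • x + t • f x = p}) :=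
          hb.isCompact_closure
        exact ((hc.image (by fun_prop : Continuous fun x => L (x - p))).isBounded).subset
          (image_mono subset_closure)
      refine h1.subset ?_
      rintro y ⟨t, ht, h⟩
      refine ⟨L.symm y + p, ⟨t, ht, ?_⟩, by simp⟩
      have h2 := congrArg L.symm h
      simp only [map_add, map_smul, L.symm_apply_apply, map_zero] at h2
      rw [← sub_eq_zero, ← h2]
      module)
  refine ⟨L.symm y + p, ?_⟩
  have := L.injective (hy.trans (map_zero L).symm)
  exact sub_eq_zero.1 this

/-! ### Lifting through affine universal coverings, and deck groups -/

section AffineCoverings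

open Metric

variable {E F : Type*} [NormedAddCommGroup E] [NormedSpace ℝ E]
  [NormedAddCommGroup F] [NormedSpace ℝ F]

/-- Locally affine maps are analytic, so the identity theorem makes one local expression global. -/
theorem exists_affineMap_eq_of_locally {k : E → F}
    (hk : ∀ x, ∃ A : E →ᴬ[ℝ] F, k =ᶠ[𝓝 x] A) : ∃ A : E →ᴬ[ℝ] F, k = A := by
  have han : ∀ A : E →ᴬ[ℝ] F, AnalyticOnNhd ℝ A univ := fun A x _ => by
    have h : (A : E → F) = fun x => A.contLinear x + A 0 := A.decomp
    rw [h]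
    exact (A.contLinear.analyticAt x).add analyticAt_const
  obtain ⟨A, hA⟩ := hk 0
  refine ⟨A, AnalyticOnNhd.eq_of_eventuallyEq (𝕜 := ℝ) (fun x _ => ?_) (han A) hA⟩
  obtain ⟨A', hA'⟩ := hk x
  exact (han A' x trivial).congr hA'.symm

section Charts

variable {M : Type*} [TopologicalSpace M] [ChartedSpace E M]

theorem IsAffineMap.continuous {N : Type*} [TopologicalSpace N] [ChartedSpace F N] {f : M → N}
    (hf : IsAffineMap E F f) : Continuous f :=
  (ChartedSpace.liftProp_iff.1 hf).1

theorem IsAffineMap.eventually_chart {g : F → M} (hg : IsAffineMap F E g) (z : F) :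
    ∃ A : F →ᴬ[ℝ] E, ∀ᶠ y in 𝓝 z, chartAt E (g z) (g y) = A y := by
  obtain ⟨A, hA⟩ := (ChartedSpace.liftProp_iff.1 hg).2 z
  rw [nhdsWithin_univ] at hA
  rw [chartAt_self_eq] at hA
  exact ⟨A, hA⟩

theorem IsAffineMap.comp {N : Type*} [TopologicalSpace N] [ChartedSpace E N] {Φ : M → N}
    {g : F → M} (hΦ : IsAffineMap E E Φ) (hg : IsAffineMap F E g) :
    IsAffineMap F E (Φ ∘ g) := by
  refine ChartedSpace.liftProp_iff.2 ⟨hΦ.continuous.comp hg.continuous, fun z => ?_⟩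
  obtain ⟨A, hA⟩ := hg.eventually_chart z
  obtain ⟨A', hA'⟩ := (ChartedSpace.liftProp_iff.1 hΦ).2 (g z)
  rw [nhdsWithin_univ] at hA'
  refine ⟨A'.comp A, ?_⟩
  rw [nhdsWithin_univ]
  have hc : Filter.Tendsto (fun y => chartAt E (g z) (g y)) (𝓝 z)
      (𝓝 (chartAt E (g z) (g z))) :=
    ((chartAt E (g z)).continuousAt (mem_chart_source E (g z))).comp hg.continuous.continuousAt
  have hs : ∀ᶠ y in 𝓝 z, g y ∈ (chartAt E (g z)).source :=
    hg.continuous.continuousAt.eventually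
      ((chartAt E (g z)).open_source.mem_nhds (mem_chart_source E (g z)))
  have h1 : ∀ᶠ y in 𝓝 z, chartAt E (Φ (g z)) (Φ (g y)) = (A'.comp A) y := by
    filter_upwards [hA, hc.eventually hA', hs] with y h1 h2 h3
    simp only [Function.comp_apply, (chartAt E (g z)).left_inv h3] at h2
    rw [h2, h1]
    rfl
  rw [chartAt_self_eq]
  exact h1

theorem isAffineIso_refl : IsAffineIso E E (Homeomorph.refl M) := by
  have h : IsAffineMap E E (Homeomorph.refl M) := by
    refine ChartedSpace.liftProp_iff.2 ⟨continuous_id, fun z => ⟨ContinuousAffineMap.id ℝ E, ?_⟩⟩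
    rw [nhdsWithin_univ]
    filter_upwards [(chartAt E z).open_target.mem_nhds (mem_chart_target E z)] with y hy
    exact (chartAt E z).right_inv hy
  exact ⟨h, h⟩

variable [FiniteDimensional ℝ E]

/-- In the charts of the manifold, an affine universal covering is given by affine
isomorphisms. -/
theorem IsAffineUniversalCover.eventually_chart {p : E → M} (hp : IsAffineUniversalCover p)
    (z : E) : ∃ A : E ≃ᵃ[ℝ] E, ∀ᶠ y in 𝓝 z,
      p y ∈ (chartAt E (p z)).source ∧ chartAt E (p z) (p y) = A y := by
  obtain ⟨A, hA⟩ := hp.isAffine.eventually_chart z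
  obtain ⟨e, hze, he⟩ := hp.isCoveringMap.isLocalHomeomorph z
  have hs : ∀ᶠ y in 𝓝 z, p y ∈ (chartAt E (p z)).source :=
    hp.isAffine.continuous.continuousAt.eventually
      ((chartAt E (p z)).open_source.mem_nhds (mem_chart_source E (p z)))
  have hev := (hA.and hs).and (e.open_source.mem_nhds hze)
  -- Along a kernel vector of the linear part the chart expression, hence `p`, would be constant
  -- near `z`, against local injectivity of a covering.
  have hinj : Function.Injective A.toAffineMap.linear := by
    rw [injective_iff_map_eq_zero]
    intro v hv
    have ht : Filter.Tendsto (fun t : ℝ => z + t • v) (𝓝[≠] 0) (𝓝 z) := by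
      have : Continuous fun t : ℝ => z + t • v := by fun_prop
      simpa using (this.tendsto 0).mono_left nhdsWithin_le_nhds
    obtain ⟨t, ⟨⟨h1, h2⟩, h3⟩, ht0⟩ := ((ht.eventually hev).and self_mem_nhdsWithin).exists
    have h4 : A (z + t • v) = A z := by
      have := A.toAffineMap.map_vadd z (t • v)
      rw [map_smul, hv, smul_zero, zero_vadd, vadd_eq_add, add_comm] at this
      exact this
    have h5 : p (z + t • v) = p z := by
      apply (chartAt E (p z)).injOn h2 (mem_chart_source E (p z))
      rw [h1, h4, hA.self_of_nhds]
    rw [he] at h5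
    have h6 := e.injOn h3 hze h5
    exact (smul_eq_zero.1 (by simpa using h6)).resolve_left ht0
  have hbij : Function.Bijective A.toAffineMap := by
    rw [← AffineMap.linear_bijective_iff]
    exact ⟨hinj, LinearMap.injective_iff_surjective.1 hinj⟩
  refine ⟨AffineEquiv.ofBijective hbij, ?_⟩
  filter_upwards [hA, hs] with y h1 h2
  exact ⟨h2, h1⟩

/-- A continuous lift of an affine map through an affine universal covering is affine. -/
theorem IsAffineUniversalCover.exists_affineMap_eq_of_lift {p : E → M}
    (hp : IsAffineUniversalCover p) {g : F → M} (hg : IsAffineMap F E g) {k : F → E}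
    (hk : Continuous k) (hpk : p ∘ k = g) : ∃ A : F →ᴬ[ℝ] E, k = A := by
  refine exists_affineMap_eq_of_locally fun x => ?_
  obtain ⟨A, hA⟩ := hg.eventually_chart x
  obtain ⟨A', hA'⟩ := hp.eventually_chart (k x)
  let A'' : E →ᴬ[ℝ] E := ⟨A'.symm.toAffineMap, A'.symm.toAffineMap.continuous_of_finiteDimensional⟩
  refine ⟨A''.comp A, ?_⟩
  filter_upwards [hA, hk.continuousAt.eventually hA'] with y h1 h2
  subst hpk
  have h3 : A' (k y) = A y := h2.2.symm.trans h1
  have : k y = A'.symm (A y) := by rw [← h3, A'.symm_apply_apply]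
  exact this

variable {M₁ M₂ : Type*} [TopologicalSpace M₁] [ChartedSpace E M₁]
  [TopologicalSpace M₂] [ChartedSpace E M₂]

theorem IsAffineUniversalCover.exists_affineMap_lift {p₁ : E → M₁} {p₂ : E → M₂}
    (h₁ : IsAffineUniversalCover p₁) (h₂ : IsAffineUniversalCover p₂) {Φ : M₁ → M₂}
    (hΦ : IsAffineMap E E Φ) {z z' : E} (hz : p₂ z' = Φ (p₁ z)) :
    ∃ A : E →ᴬ[ℝ] E, A z = z' ∧ ∀ y, p₂ (A y) = Φ (p₁ y) := by
  have hg := hΦ.comp h₁.isAffine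
  obtain ⟨K, ⟨hK, hpK⟩, -⟩ := h₂.isCoveringMap.existsUnique_continuousMap_lifts
    ⟨Φ ∘ p₁, hg.continuous⟩ z z' hz
  obtain ⟨A, hA⟩ := h₂.exists_affineMap_eq_of_lift hg K.continuous hpK
  refine ⟨A, by rw [← hA, hK], fun y => ?_⟩
  rw [← hA]
  exact congrFun hpK y

/-- Affine isomorphisms lift to the universal coverings. -/
theorem IsAffineUniversalCover.exists_affineEquiv_lift {p₁ : E → M₁} {p₂ : E → M₂}
    (h₁ : IsAffineUniversalCover p₁) (h₂ : IsAffineUniversalCover p₂) {Φ : M₁ ≃ₜ M₂}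
    (hΦ : IsAffineIso E E Φ) {z z' : E} (hz : p₂ z' = Φ (p₁ z)) :
    ∃ k : E ≃ᵃ[ℝ] E, k z = z' ∧ ∀ y, p₂ (k y) = Φ (p₁ y) := by
  obtain ⟨A, hA, hAp⟩ := h₁.exists_affineMap_lift h₂ hΦ.1 hz
  obtain ⟨A', hA', hAp'⟩ := h₂.exists_affineMap_lift h₁ hΦ.2 (z := z') (z' := z)
    (by rw [hz, Φ.symm_apply_apply])
  -- Both composites and the identity lift the same covering map and agree at one point.
  have hl : ∀ y, A' (A y) = y := by
    have h := h₁.isCoveringMap.eq_of_comp_eq (A'.continuous.comp A.continuous) continuous_id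
      (by funext y; simp [hAp', hAp]) z (by simp [hA, hA'])
    exact congrFun h
  have hr : ∀ y, A (A' y) = y := by
    have h := h₂.isCoveringMap.eq_of_comp_eq (A.continuous.comp A'.continuous) continuous_id
      (by funext y; simp [hAp', hAp]) z' (by simp [hA, hA'])
    exact congrFun h
  exact ⟨AffineEquiv.ofBijective (φ := A.toAffineMap)
    ⟨Function.LeftInverse.injective hl, Function.RightInverse.surjective hr⟩, hA, hAp⟩

theorem IsAffineUniversalCover.exists_deck {p : E → M} (hp : IsAffineUniversalCover p) {z z' : E}
    (hz : p z = p z') : ∃ γ ∈ deckGroup p, γ z = z' := by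
  obtain ⟨γ, h1, h2⟩ := hp.exists_affineEquiv_lift hp isAffineIso_refl (z := z) (z' := z') hz.symm
  exact ⟨γ, h2, h1⟩

theorem IsAffineUniversalCover.deck_eq {p : E → M} (hp : IsAffineUniversalCover p)
    {γ γ' : E ≃ᵃ[ℝ] E} (hγ : γ ∈ deckGroup p) (hγ' : γ' ∈ deckGroup p) {z : E}
    (hz : γ z = γ' z) : γ = γ' := by
  refine AffineEquiv.coeFn_injective (hp.isCoveringMap.eq_of_comp_eq
    γ.toAffineMap.continuous_of_finiteDimensional γ'.toAffineMap.continuous_of_finiteDimensional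
    ?_ z hz)
  funext y
  exact (hγ y).trans (hγ' y).symm

/-- The deck transformation group acts properly discontinuously. -/
theorem IsAffineUniversalCover.finite_deck [T2Space M] {p : E → M}
    (hp : IsAffineUniversalCover p) {K : Set E} (hK : IsCompact K) :
    {γ : E ≃ᵃ[ℝ] E | γ ∈ deckGroup p ∧ ∃ x ∈ K, γ x ∈ K}.Finite := by
  have hcont := hp.isAffine.continuous
  let R : Set (E × E) := (K ×ˢ K) ∩ {x | p x.1 = p x.2}
  have hR : IsCompact R := (hK.prod hK).inter_right
    (isClosed_eq (hcont.comp continuous_fst) (hcont.comp continuous_snd))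
  -- Near each of its points, the compact set of equivalent pairs is part of the graph of a single
  -- deck transformation, so finitely many cover it.
  have hloc : ∀ x ∈ R, ∃ U ∈ 𝓝 x, ∃ γ ∈ deckGroup p, ∀ y ∈ U ∩ R, γ y.1 = y.2 := by
    rintro ⟨x, y⟩ ⟨-, hxy⟩
    obtain ⟨γ, hγ, hγx⟩ := hp.exists_deck hxy
    obtain ⟨e, hye, he⟩ := hp.isCoveringMap.isLocalHomeomorph y
    have hγc : Continuous γ := γ.toAffineMap.continuous_of_finiteDimensional
    have hU : (γ ⁻¹' e.source) ×ˢ e.source ∈ 𝓝 (x, y) := by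
      refine prod_mem_nhds ((e.open_source.preimage hγc).mem_nhds ?_) (e.open_source.mem_nhds hye)
      simpa only [mem_preimage, hγx] using hye
    refine ⟨_, hU, γ, hγ, ?_⟩
    rintro ⟨x', y'⟩ ⟨⟨h1, h2⟩, -, h3⟩
    refine e.injOn h1 h2 ?_
    rw [← he]
    exact (hγ x').trans h3
  choose! U hU γ hγ hUγ using hloc
  obtain ⟨t, ht, hcov⟩ := hR.elim_nhds_subcover U hU
  refine (t.finite_toSet.image γ).subset ?_
  rintro δ ⟨hδ, x, hx, hδx⟩
  have hmem : (x, δ x) ∈ R := ⟨⟨hx, hδx⟩, (hδ x).symm⟩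
  obtain ⟨i, hi, hxi⟩ := mem_iUnion₂.1 (hcov hmem)
  exact ⟨i, hi, hp.deck_eq (hγ i (ht i hi)) hδ (hUγ i (ht i hi) _ ⟨hxi, hmem⟩)⟩

/-- The deck transformation group of a compact manifold acts cocompactly. -/
theorem IsAffineUniversalCover.exists_deck_mem_ball [CompactSpace M] {p : E → M}
    (hp : IsAffineUniversalCover p) :
    ∃ r : ℝ, ∀ x, ∃ γ ∈ deckGroup p, ∃ d ∈ ball (0 : E) r, γ d = x := by
  obtain ⟨r, hr⟩ := isCompact_univ.elim_directed_cover (fun r : ℝ => p '' ball (0 : E) r)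
    (fun r => hp.isCoveringMap.isOpenMap _ isOpen_ball)
    (fun m _ => by
      obtain ⟨x, rfl⟩ := hp.surjective m
      exact mem_iUnion.2 ⟨‖x‖ + 1, x, by simp, rfl⟩)
    (Monotone.directed_le fun a b hab => image_mono (ball_subset_ball hab))
  refine ⟨r, fun x => ?_⟩
  obtain ⟨d, hd, hdx⟩ := hr (mem_univ (p x))
  obtain ⟨γ, hγ, hγd⟩ := hp.exists_deck hdx
  exact ⟨γ, hγ, d, hd, hγd⟩

/-- The fundamental group of a compact complete affine manifold leaves no proper linear
subspace invariant: a subspace that contains the orbit of the origin is everything. -/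
theorem IsAffineUniversalCover.eq_top_of_deck_zero_mem [CompactSpace M] [T2Space M] {p : E → M}
    (hp : IsAffineUniversalCover p) (T : Submodule ℝ E) (hT : ∀ γ ∈ deckGroup p, γ 0 ∈ T) :
    T = ⊤ := by
  obtain ⟨r, hr⟩ := hp.exists_deck_mem_ball
  let D : Set E := closedBall 0 r
  let t : E → Set E := fun x => convexHull ℝ
    {y | ∃ γ ∈ deckGroup p, γ 0 = y ∧ ∃ d ∈ D, γ d = x}
  -- A smooth partition of unity glues local constants. The constant `γ 0` is admissible near `γ d`
  -- because `d` is in the open ball, while `t` allows the closed one.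
  obtain ⟨f, hf⟩ := exists_contMDiffMap_forall_mem_convex_of_local_const 𝓘(ℝ, E) (n := 1)
    (t := t) (fun x => convex_convexHull ℝ _) (fun x => by
      obtain ⟨γ, hγ, d, hd, rfl⟩ := hr x
      refine ⟨γ 0, ?_⟩
      have hc : Continuous γ.symm := γ.symm.toAffineMap.continuous_of_finiteDimensional
      have hev : ∀ᶠ y in 𝓝 (γ d), γ.symm y ∈ ball (0 : E) r :=
        hc.continuousAt.eventually (isOpen_ball.mem_nhds (by simpa using hd))
      filter_upwards [hev] with y hy
      exact subset_convexHull ℝ _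
        ⟨γ, hγ, rfl, γ.symm y, ball_subset_closedBall hy, γ.apply_symm_apply y⟩)
  have hfT : ∀ x, f x ∈ T := fun x => by
    refine convexHull_min ?_ T.convex (hf x)
    rintro _ ⟨γ, hγ, rfl, -⟩
    exact hT γ hγ
  have hF₁ := hp.finite_deck (isCompact_closedBall (0 : E) r)
  rw [Submodule.eq_top_iff']
  intro y
  -- If γ and γ' both carry points of D to x, then γ⁻¹γ' lies in a finite set. So, seen through γ⁻¹,
  -- both x and f(x) stay in a ball independent of x; `ρ'` is enlarged to contain `y` too.
  obtain ⟨ρ, hρ⟩ := (hF₁.image fun δ : E ≃ᵃ[ℝ] E => ‖δ 0‖).bddAbove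
  let ρ' := max (max ρ r) ‖y‖
  have hF₂ := hp.finite_deck (isCompact_closedBall (0 : E) ρ')
  obtain ⟨x, rfl⟩ := exists_eq_of_isBounded_homotopy (f := f) f.contMDiff.contDiff y (by
    refine ((Bornology.isBounded_biUnion hF₂).2 fun γ _ =>
      ((isCompact_closedBall (0 : E) r).image
        γ.toAffineMap.continuous_of_finiteDimensional).isBounded).subset ?_
    rintro x ⟨s, hs, hx⟩
    obtain ⟨γ, hγ, d, hd, rfl⟩ := hr x
    have hconv : Convex ℝ (γ.toAffineMap '' closedBall 0 ρ') :=
      (convex_closedBall (0 : E) ρ').affine_image γ.toAffineMap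
    have hfx : f (γ d) ∈ γ.toAffineMap '' closedBall 0 ρ' := by
      refine convexHull_min ?_ hconv (hf (γ d))
      rintro _ ⟨γ', hγ', rfl, d', hd', h'⟩
      have hδ : ‖(γ⁻¹ * γ' : E ≃ᵃ[ℝ] E) 0‖ ≤ ρ := by
        refine hρ ⟨_, ⟨mul_mem (inv_mem hγ) hγ', d', hd', ?_⟩, rfl⟩
        have : (γ⁻¹ * γ' : E ≃ᵃ[ℝ] E) d' = d := by
          change γ.symm (γ' d') = d
          rw [h', γ.symm_apply_apply]
        rw [this]
        exact ball_subset_closedBall hd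
      refine ⟨(γ⁻¹ * γ' : E ≃ᵃ[ℝ] E) 0, ?_, γ.apply_symm_apply _⟩
      exact mem_closedBall_zero_iff.2 (hδ.trans ((le_max_left _ _).trans (le_max_left _ _)))
    have hdx : γ d ∈ γ.toAffineMap '' closedBall 0 ρ' :=
      ⟨d, closedBall_subset_closedBall ((le_max_right _ _).trans (le_max_left _ _))
        (ball_subset_closedBall hd), rfl⟩
    -- The point `y` of the segment from x to f(x) is thus γ of a point of the `ρ'`-ball, which also
    -- contains `y`: only finitely many γ occur, and x stays in the union of their translates of D.
    have hy := hconv hdx hfx (sub_nonneg.2 hs.2) hs.1 (sub_add_cancel 1 s)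
    rw [hx] at hy
    obtain ⟨e, he, hey⟩ := hy
    refine mem_biUnion (x := γ) ⟨hγ, e, he, ?_⟩ ⟨d, ball_subset_closedBall hd, rfl⟩
    rw [show γ e = y from hey]
    exact mem_closedBall_zero_iff.2 (le_max_right _ _))
  exact hfT x

end Charts

end AffineCoverings

/-! ### Descent of affine isomorphisms from the coverings -/

section DescentOfAffineEquivs

variable {E : Type*} [NormedAddCommGroup E] [NormedSpace ℝ E] [FiniteDimensional ℝ E]
  {M₁ M₂ : Type*} [TopologicalSpace M₁] [ChartedSpace E M₁]
  [TopologicalSpace M₂] [ChartedSpace E M₂] {p₁ : E → M₁} {p₂ : E → M₂}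

theorem IsAffineUniversalCover.isAffineMap_of_lift (h₁ : IsAffineUniversalCover p₁)
    (h₂ : IsAffineUniversalCover p₂) {Φ : M₁ → M₂} {k : E ≃ᵃ[ℝ] E}
    (hΦ : ∀ z, Φ (p₁ z) = p₂ (k z)) : IsAffineMap E E Φ := by
  have hkc : Continuous k := k.toAffineMap.continuous_of_finiteDimensional
  refine ChartedSpace.liftProp_iff.2 ⟨?_, fun m => ?_⟩
  · rw [(h₁.isCoveringMap.isOpenMap.isQuotientMap h₁.isCoveringMap.continuous
      h₁.surjective).continuous_iff, show Φ ∘ p₁ = p₂ ∘ k from funext hΦ]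
    exact h₂.isCoveringMap.continuous.comp hkc
  · obtain ⟨z, rfl⟩ := h₁.surjective m
    obtain ⟨A₁, hA₁⟩ := h₁.eventually_chart z
    obtain ⟨A₂, hA₂⟩ := h₂.eventually_chart (k z)
    have hA₁z := hA₁.self_of_nhds.2
    -- The expression of `Φ` in charts: go up by the inverse of `A₁`, apply `k`, come down by `A₂`.
    let A : E ≃ᵃ[ℝ] E := (A₁.symm.trans k).trans A₂
    refine ⟨⟨A.toAffineMap, A.toAffineMap.continuous_of_finiteDimensional⟩, ?_⟩
    rw [nhdsWithin_univ, hA₁z, hΦ]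
    have hc : Filter.Tendsto A₁.symm (𝓝 (A₁ z)) (𝓝 z) := by
      have h : Continuous A₁.symm := A₁.symm.toAffineMap.continuous_of_finiteDimensional
      simpa using h.tendsto (A₁ z)
    filter_upwards [hc.eventually hA₁, (hkc.continuousAt.tendsto.comp hc).eventually hA₂]
      with y hy₁ hy₂
    have h3 : (chartAt E (p₁ z)).symm y = p₁ (A₁.symm y) := by
      rw [← (chartAt E (p₁ z)).left_inv hy₁.1, hy₁.2, A₁.apply_symm_apply]
    simp only [Function.comp_apply] at hy₂ ⊢
    rw [h3, hΦ, hy₂.2]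
    rfl

/-- An affine isomorphism of the universal coverings compatible with the covering maps descends. -/
theorem IsAffineUniversalCover.exists_affineIso_of_lift (h₁ : IsAffineUniversalCover p₁)
    (h₂ : IsAffineUniversalCover p₂) (k : E ≃ᵃ[ℝ] E)
    (hk : ∀ z z', p₁ z = p₁ z' ↔ p₂ (k z) = p₂ (k z')) :
    ∃ Φ : M₁ ≃ₜ M₂, IsAffineIso E E Φ ∧ ∀ z, Φ (p₁ z) = p₂ (k z) := by
  let F : M₁ → M₂ := fun m => p₂ (k (Function.surjInv h₁.surjective m))
  let F' : M₂ → M₁ := fun m => p₁ (k.symm (Function.surjInv h₂.surjective m))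
  have hF : ∀ z, F (p₁ z) = p₂ (k z) := fun z =>
    (hk _ _).1 (Function.surjInv_eq h₁.surjective (p₁ z))
  have hF' : ∀ z, F' (p₂ z) = p₁ (k.symm z) := fun z => by
    rw [hk, k.apply_symm_apply, k.apply_symm_apply]
    exact Function.surjInv_eq h₂.surjective (p₂ z)
  have ha := h₁.isAffineMap_of_lift h₂ hF
  have ha' := h₂.isAffineMap_of_lift h₁ hF'
  refine ⟨⟨⟨F, F', fun m => ?_, fun m => ?_⟩, ha.continuous, ha'.continuous⟩, ⟨ha, ha'⟩, hF⟩
  · obtain ⟨z, rfl⟩ := h₁.surjective m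
    rw [hF, hF', k.symm_apply_apply]
  · obtain ⟨z, rfl⟩ := h₂.surjective m
    rw [hF', hF, k.apply_symm_apply]

end DescentOfAffineEquivs

/-! ### Product rule in `Aff(V, W)` and conjugation by fibre translations -/

section FibreAffineFormulas

variable {V W : Type*} [NormedAddCommGroup V] [NormedSpace ℝ V]
  [NormedAddCommGroup W] [NormedSpace ℝ W]

theorem fibAff_apply (g : fibAff V W) (z : V × W) :
    g.1 z = (blockA g.1 z.1 + basePart g.1 0,
      blockB g.1 z.2 + blockC g.1 z.1 + vecD g.1) := by
  have h : g.1 z = g.1.linear z + g.1 0 := by simpa using g.1.map_vadd 0 z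
  rw [h, linear_eq_blocks]
  rfl

/-- The middle term is the defect of d from being a cocycle; through it d determines C on the
translation parts of the base action. -/
theorem vecD_mul (g h : fibAff V W) :
    vecD (g * h).1 = blockB g.1 (vecD h.1) + blockC g.1 (basePart h.1 0) + vecD g.1 :=
  congrArg Prod.snd (fibAff_apply g (h.1 0))

variable (V) in
/-- The translation of the fibres by `e`. -/
def fibreTranslation (e : W) : fibAff V W :=
  ⟨AffineEquiv.constVAdd ℝ (V × W) (0, e), fun z z' => by
    simp [AffineEquiv.constVAdd_apply]⟩

theorem fibreTranslation_apply (e : W) (z : V × W) :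
    (fibreTranslation V e).1 z = (z.1, e + z.2) := by
  simp [fibreTranslation, AffineEquiv.constVAdd_apply, Prod.ext_iff]

variable {G : Type*} [Group G]

/-- If the translations of `V` span `V`, representations with the same classes `[C]` and `[D]`
which induce the same action on `V` are conjugate by a translation of the fibres. -/
theorem SameClasses.exists_fibreTranslation_conj {ρ' ρ : G →* fibAff V W}
    (hs : SameClasses ρ' ρ) (hbase : ∀ γ, basePart (ρ' γ).1 0 = basePart (ρ γ).1 0)
    (hspan : Submodule.span ℝ (range fun γ => basePart (ρ γ).1 0) = ⊤) :
    ∃ e : W, ∀ γ, fibreTranslation V e * ρ' γ = ρ γ * fibreTranslation V e := by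
  obtain ⟨hA, hB, -, hD⟩ := hs
  obtain ⟨e, he⟩ := (Submodule.Quotient.eq _).1 hD
  have hA' : ∀ γ, blockA (ρ' γ).1 = blockA (ρ γ).1 := fun γ => DFunLike.congr_fun hA γ
  have hB' : ∀ γ, blockB (ρ' γ).1 = blockB (ρ γ).1 := fun γ => DFunLike.congr_fun hB γ
  have hD' : ∀ γ, vecD (ρ' γ).1 = vecD (ρ γ).1 + (blockB (ρ γ).1 e - e) := fun γ => by
    have h : blockB (ρ γ).1 e - e = vecD (ρ' γ).1 - vecD (ρ γ).1 := congrFun he γ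
    rw [h, add_sub_cancel]
  -- In the product rule for `γ * δ` all contributions of `e` cancel, leaving the equality of both C
  -- blocks on the translation part of `δ`.
  have hC : ∀ γ, blockC (ρ' γ).1 = blockC (ρ γ).1 := by
    intro γ
    refine LinearMap.ext_on hspan ?_
    rintro _ ⟨δ, rfl⟩
    have h1 := hD' (γ * δ)
    have hBm : blockB (ρ (γ * δ)).1 e = blockB (ρ γ).1 (blockB (ρ δ).1 e) := by
      have := DFunLike.congr_fun (homB.map_mul (ρ γ) (ρ δ)) e
      rw [← map_mul ρ] at this
      exact this
    rw [hBm, map_mul, map_mul, vecD_mul, vecD_mul, hD', hD', hB', hbase, map_add, map_sub] at h1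
    have h2 : blockC (ρ' γ).1 (basePart (ρ δ).1 0) - blockC (ρ γ).1 (basePart (ρ δ).1 0) = 0 := by
      rw [← sub_eq_zero] at h1
      rw [← h1]
      abel
    exact sub_eq_zero.1 h2
  refine ⟨e, fun γ => Subtype.ext (AffineEquiv.ext fun z => ?_)⟩
  have hl : (fibreTranslation V e * ρ' γ).1 z = (fibreTranslation V e).1 ((ρ' γ).1 z) := rfl
  have hr : (ρ γ * fibreTranslation V e).1 z = (ρ γ).1 ((fibreTranslation V e).1 z) := rfl
  rw [hl, hr, fibreTranslation_apply, fibreTranslation_apply, fibAff_apply, fibAff_apply]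
  simp only [hA', hB', hC, hD', hbase, map_add]
  ext
  · rfl
  · simp only
    abel

end FibreAffineFormulas

/-! ### Bundle isomorphisms and elements of `Aff(V, W)` -/

section BundleIsomorphisms

variable {V W : Type*} [NormedAddCommGroup V] [NormedSpace ℝ V]
  [NormedAddCommGroup W] [NormedSpace ℝ W]

theorem exists_liftedTotal_homeomorph [FiniteDimensional ℝ V] [FiniteDimensional ℝ W]
    {M₁ M₂ : Type*} {p₁ : V × W → M₁} {p₂ : V × W → M₂} (k : (V × W) ≃ᵃ[ℝ] (V × W))
    (hk : ∀ γ, γ ∈ fibreGroup p₁ ↔ k * γ * k⁻¹ ∈ fibreGroup p₂) :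
    ∃ Ψ : LiftedTotal p₁ ≃ₜ LiftedTotal p₂,
      ∀ z : V × W, Ψ (Quotient.mk (fibreSetoid p₁) z) = Quotient.mk (fibreSetoid p₂) (k z) := by
  have hkc : Continuous k := k.toAffineMap.continuous_of_finiteDimensional
  have hkc' : Continuous k.symm := k.symm.toAffineMap.continuous_of_finiteDimensional
  have hrel : ∀ z z', (fibreSetoid p₁).r z z' ↔ (fibreSetoid p₂).r (k z) (k z') := by
    intro z z'
    constructor
    · rintro ⟨γ, hγ, rfl⟩
      refine ⟨k * γ * k⁻¹, (hk γ).1 hγ, ?_⟩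
      change k (γ (k.symm (k z))) = k (γ z)
      rw [k.symm_apply_apply]
    · rintro ⟨γ, hγ, h⟩
      refine ⟨k⁻¹ * γ * k, (hk _).2 (by simpa [mul_assoc] using hγ), ?_⟩
      change k.symm (γ (k z)) = z'
      rw [h, k.symm_apply_apply]
  let Ψ : LiftedTotal p₁ ≃ LiftedTotal p₂ := Quotient.congr k.toEquiv hrel
  refine ⟨⟨Ψ, ?_, ?_⟩, fun z => rfl⟩
  · exact continuous_quot_lift _ (continuous_quot_mk.comp hkc)
  · exact continuous_quot_lift _ (continuous_quot_mk.comp hkc')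

variable {B M₁ M₂ : Type*} [TopologicalSpace B] [ChartedSpace V B]
  [TopologicalSpace M₁] [ChartedSpace (V × W) M₁]
  [TopologicalSpace M₂] [ChartedSpace (V × W) M₂]

/-- Restricted to a fibre, the base component of `k` lifts a constant map, so it is constant by
uniqueness of lifts. -/
theorem IsAffineUniversalCover.fst_eq_of_semiconj {q : V → B} (hq : IsAffineUniversalCover q)
    {k : V × W → V × W} (hk : Continuous k) {φ : B → B} (hφ : ∀ z, q (k z).1 = φ (q z.1))
    {z z' : V × W} (hz : z.1 = z'.1) : (k z).1 = (k z').1 := by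
  have h := hq.isCoveringMap.eq_of_comp_eq (g₁ := fun w : W => (k (z.1, w)).1)
    (g₂ := fun _ => (k z).1) (by fun_prop) continuous_const
    (by funext w; simp [hφ]) z.2 rfl
  have h' := congrFun h z'.2
  rw [show z' = (z.1, z'.2) from Prod.ext hz.symm rfl]
  exact h'.symm

/-- If `k` conjugates the fundamental groups and covers an automorphism of the base, it descends
to an isomorphism of affine bundles. -/
theorem IsAdaptedCover.affineBundleIso_of_conj [FiniteDimensional ℝ V] [FiniteDimensional ℝ W]
    {f₁ : M₁ → B} {f₂ : M₂ → B} {q : V → B} {p₁ : V × W → M₁} {p₂ : V × W → M₂}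
    (h₁ : IsAdaptedCover f₁ q p₁) (h₂ : IsAdaptedCover f₂ q p₂) (k : fibAff V W)
    (hk : ∀ γ, γ ∈ deckGroup p₁ ↔ k.1 * γ * k.1⁻¹ ∈ deckGroup p₂) (φ : B ≃ₜ B)
    (hφ : IsAffineIso V V φ) (hφk : ∀ v : V, q (basePart k.1 v) = φ (q v)) :
    AffineBundleIso V W f₁ f₂ := by
  obtain ⟨Φ, hΦ, hΦk⟩ := h₁.total.exists_affineIso_of_lift h₂.total k.1 (fun z z' => by
    constructor
    · intro h
      obtain ⟨γ, hγ, rfl⟩ := h₁.total.exists_deck h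
      have := (hk γ).1 hγ (k.1 z)
      change p₂ (k.1 (γ (k.1.symm (k.1 z)))) = p₂ (k.1 z) at this
      rw [k.1.symm_apply_apply] at this
      exact this.symm
    · intro h
      obtain ⟨γ, hγ, hγz⟩ := h₂.total.exists_deck h
      have := (hk (k.1⁻¹ * γ * k.1)).2 (by simpa [mul_assoc] using hγ) z
      change p₁ (k.1.symm (γ (k.1 z))) = p₁ z at this
      rw [hγz, k.1.symm_apply_apply] at this
      exact this.symm)
  refine ⟨Φ, φ, hΦ, hφ, fun x => ?_⟩
  obtain ⟨z, rfl⟩ := h₁.total.surjective x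
  rw [hΦk, h₂.comm, h₁.comm, ← hφk]
  exact congrArg q ((k.2 z (z.1, 0)).2 rfl)

/-- An isomorphism of affine bundles lifts to an element of `Aff(V, W)`. -/
theorem IsAdaptedCover.exists_fibAff_lift [FiniteDimensional ℝ V] [FiniteDimensional ℝ W]
    {f₁ : M₁ → B} {f₂ : M₂ → B} {q : V → B} {p₁ : V × W → M₁} {p₂ : V × W → M₂}
    (h₁ : IsAdaptedCover f₁ q p₁) (h₂ : IsAdaptedCover f₂ q p₂) {Φ : M₁ ≃ₜ M₂} {φ : B ≃ₜ B}
    (hΦ : IsAffineIso (V × W) (V × W) Φ) (hcomm : ∀ x, f₂ (Φ x) = φ (f₁ x)) :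
    ∃ k : fibAff V W, ∀ z, p₂ (k.1 z) = Φ (p₁ z) := by
  obtain ⟨z', hz'⟩ := h₂.total.surjective (Φ (p₁ 0))
  obtain ⟨k, -, hk⟩ := h₁.total.exists_affineEquiv_lift h₂.total hΦ hz'
  have hk' : ∀ z, p₁ (k.symm z) = Φ.symm (p₂ z) := fun z => by
    rw [Φ.eq_symm_apply, ← hk, k.apply_symm_apply]
  have hq : ∀ z, q (k z).1 = φ (q z.1) := fun z => by
    rw [← h₂.comm, hk, hcomm, h₁.comm]
  have hq' : ∀ z, q (k.symm z).1 = φ.symm (q z.1) := fun z => by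
    rw [← h₁.comm, hk', φ.eq_symm_apply, ← hcomm, Φ.apply_symm_apply, h₂.comm]
  refine ⟨⟨k, fun z z' => ⟨fun h => ?_, fun h => ?_⟩⟩, hk⟩
  · have := h₁.base.fst_eq_of_semiconj k.symm.toAffineMap.continuous_of_finiteDimensional hq' h
    simpa using this
  · exact h₁.base.fst_eq_of_semiconj k.toAffineMap.continuous_of_finiteDimensional hq h

/-- The translation parts of the action of the fundamental group of a compact total space on `V`
span `V`. -/
theorem IsAdaptedCover.span_basePart_zero [FiniteDimensional ℝ V] [FiniteDimensional ℝ W]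
    {M : Type*} [TopologicalSpace M] [ChartedSpace (V × W) M] [CompactSpace M] [T2Space M]
    {f : M → B} {q : V → B} {p : V × W → M} (h : IsAdaptedCover f q p) {G : Type*} [Group G]
    (ι : G ≃* deckGroup p) :
    Submodule.span ℝ (range fun γ => basePart (h.holonomy ι γ).1 0) = ⊤ := by
  set S := Submodule.span ℝ (range fun γ => basePart (h.holonomy ι γ).1 0) with hS
  -- The preimage of the span in `V × W` contains the orbit of the origin, so it is the whole space.
  have hT := h.total.eq_top_of_deck_zero_mem (S.comap (LinearMap.fst ℝ V W)) (fun γ hγ => by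
    refine Submodule.subset_span ⟨ι.symm ⟨γ, hγ⟩, ?_⟩
    have : (h.holonomy ι (ι.symm ⟨γ, hγ⟩)).1 = γ :=
      congrArg Subtype.val (ι.apply_symm_apply ⟨γ, hγ⟩)
    simp only [this]
    rfl)
  rw [Submodule.eq_top_iff'] at hT ⊢
  exact fun v => hT (v, 0)

end BundleIsomorphisms

theorem mem_deckGroup_iff_conj_mem {E M₁ M₂ : Type*} [NormedAddCommGroup E] [NormedSpace ℝ E]
    {p₁ : E → M₁} {p₂ : E → M₂} {k : E ≃ᵃ[ℝ] E} {Φ : M₁ ≃ M₂} (hk : ∀ z, p₂ (k z) = Φ (p₁ z))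
    (γ : E ≃ᵃ[ℝ] E) : γ ∈ deckGroup p₁ ↔ k * γ * k⁻¹ ∈ deckGroup p₂ := by
  have hk' : ∀ z, p₁ z = Φ.symm (p₂ (k z)) := fun z => by rw [hk, Φ.symm_apply_apply]
  constructor
  · intro h z
    change p₂ (k (γ (k.symm z))) = p₂ z
    rw [hk, h, ← hk, k.apply_symm_apply]
  · intro h z
    have h' : p₂ (k (γ (k.symm (k z)))) = p₂ (k z) := h (k z)
    rw [k.symm_apply_apply] at h'
    rw [hk', hk' z, h']

end

/-! ### The equivalence -/

theorem mainTheorem4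
    {V W : Type*}
    [NormedAddCommGroup V] [NormedSpace ℝ V] [FiniteDimensional ℝ V]
    [NormedAddCommGroup W] [NormedSpace ℝ W] [FiniteDimensional ℝ W]
    {B M₁ M₂ : Type*}
    -- the base and the two total spaces: affine manifolds, the total spaces being compact
    [TopologicalSpace B] [T2Space B] [ChartedSpace V B] [HasGroupoid B (affineGroupoid V)]
    [TopologicalSpace M₁] [T2Space M₁] [CompactSpace M₁]
    [ChartedSpace (V × W) M₁] [HasGroupoid M₁ (affineGroupoid (V × W))]
    [TopologicalSpace M₂] [T2Space M₂] [CompactSpace M₂]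
    [ChartedSpace (V × W) M₂] [HasGroupoid M₂ (affineGroupoid (V × W))]
    -- the two affine bundles
    (f₁ : M₁ → B) (f₂ : M₂ → B)
    (hf₁ : IsAffineBundle V W f₁) (hf₂ : IsAffineBundle V W f₂)
    -- completeness of the total spaces, with coordinates adapted to the bundles
    (q : V → B) (p₁ : V × W → M₁) (p₂ : V × W → M₂)
    (h₁ : IsAdaptedCover f₁ q p₁) (h₂ : IsAdaptedCover f₂ q p₂)
    -- diffeomorphic fibres with the same linear holonomy
    (hdiff : DiffeomorphicFibres V W f₁ f₂) (hhol : SameFibreLinearHolonomy p₁ p₂)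
    -- the common fundamental group of the total spaces
    {G : Type*} [Group G] (ι₁ : G ≃* deckGroup p₁) (ι₂ : G ≃* deckGroup p₂) :
    List.TFAE [
      AffineBundleIso V W f₁ f₂,
      -- `k` conjugates the whole linear holonomies; `θ` is induced by `k` on `π₁(B)` and `π₁(F)`
      ∃ (k : fibAff V W) (θ : G ≃* G),
        LiftsIsoOverAut q p₁ p₂ k ∧
        (∀ γ v, basePart (conjRep k θ (h₁.holonomy ι₁) γ).1 v =
          basePart (h₂.holonomy ι₂ γ).1 v) ∧
        (∀ γ, (h₂.holonomy ι₂ γ).1 ∈ fibreGroup p₂ →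
          conjRep k θ (h₁.holonomy ι₁) γ = h₂.holonomy ι₂ γ) ∧
        (∀ γ, (conjRep k θ (h₁.holonomy ι₁) γ).1.linear = (h₂.holonomy ι₂ γ).1.linear) ∧
        SameClasses (conjRep k θ (h₁.holonomy ι₁)) (h₂.holonomy ι₂),
      -- `k` conjugates the diagonal blocks of the linear holonomies; `θ` is induced on `π₁(B)`
      ∃ (k : fibAff V W) (θ : G ≃* G),
        LiftsIsoOverAut q p₁ p₂ k ∧
        (∀ γ v, basePart (conjRep k θ (h₁.holonomy ι₁) γ).1 v =
          basePart (h₂.holonomy ι₂ γ).1 v) ∧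
        SameClasses (conjRep k θ (h₁.holonomy ι₁)) (h₂.holonomy ι₂)] := by
  have hval₁ : ∀ γ, (h₁.holonomy ι₁ γ).1 = (ι₁ γ : (V × W) ≃ᵃ[ℝ] (V × W)) := fun _ => rfl
  have hval₂ : ∀ γ, (h₂.holonomy ι₂ γ).1 = (ι₂ γ : (V × W) ≃ᵃ[ℝ] (V × W)) := fun _ => rfl
  tfae_have 1 → 2 := by
    rintro ⟨Φ, φ, hΦ, hφ, hcomm⟩
    obtain ⟨k, hk⟩ := h₁.exists_fibAff_lift h₂ hΦ hcomm
    have hdeck := mem_deckGroup_iff_conj_mem hk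
    have hmap : (deckGroup p₁).map (MulAut.conj k.1).toMonoidHom = deckGroup p₂ := by
      ext γ
      rw [Subgroup.mem_map]
      constructor
      · rintro ⟨δ, hδ, rfl⟩
        exact (hdeck δ).1 hδ
      · intro hγ
        exact ⟨k.1⁻¹ * γ * k.1, (hdeck _).2 (by simpa [mul_assoc] using hγ), by
          simp [mul_assoc]⟩
    let c : deckGroup p₁ ≃* deckGroup p₂ :=
      ((MulAut.conj k.1).subgroupMap (deckGroup p₁)).trans (MulEquiv.subgroupCongr hmap)
    -- With `θ` read off from conjugation by `k`, the transformed representation equals the second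
    -- one, so every condition in 2 on the representations is trivial.
    let θ : G ≃* G := (ι₁.trans c).trans ι₂.symm
    have hconj : conjRep k θ (h₁.holonomy ι₁) = h₂.holonomy ι₂ := by
      ext1 γ
      obtain ⟨δ, rfl⟩ := θ.surjective γ
      refine Subtype.ext ?_
      have h3 : ι₂ (θ δ) = c (ι₁ δ) := ι₂.apply_symm_apply _
      rw [hval₂, h3]
      change k.1 * (h₁.holonomy ι₁ (θ.symm (θ δ))).1 * k.1⁻¹ = k.1 * (ι₁ δ).1 * k.1⁻¹
      rw [θ.symm_apply_apply, hval₁]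
    refine ⟨k, θ, ⟨exists_liftedTotal_homeomorph k.1 fun γ => ?_, φ, hφ, fun v => ?_⟩, ?_⟩
    · refine and_congr (hdeck γ) ⟨fun h z => ?_, fun h z => ?_⟩
      · have := (k.2 (γ (k.1.symm z)) (k.1.symm z)).2 (h _)
        rwa [k.1.apply_symm_apply] at this
      · have := h (k.1 z)
        change (k.1 (γ (k.1.symm (k.1 z)))).1 = (k.1 z).1 at this
        rw [k.1.symm_apply_apply] at this
        exact (k.2 _ _).1 this
    · change q (k.1 (v, 0)).1 = _
      rw [← h₂.comm, hk, hcomm, h₁.comm]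
    · rw [hconj]
      exact ⟨fun _ _ => rfl, fun _ _ => rfl, fun _ => rfl, rfl, rfl, rfl, rfl⟩
  tfae_have 2 → 3 := fun ⟨k, θ, hlift, hbase, _, _, hs⟩ => ⟨k, θ, hlift, hbase, hs⟩
  tfae_have 3 → 1 := by
    rintro ⟨k, θ, ⟨-, φ, hφ, hφk⟩, hbase, hs⟩
    obtain ⟨e, he⟩ := hs.exists_fibreTranslation_conj (fun γ => hbase γ 0)
      (h₂.span_basePart_zero ι₂)
    -- The corrected lift conjugates one deck group onto the other, and still covers `φ` because
    -- fibre translations act trivially on V.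
    have hconj : ∀ γ, (fibreTranslation V e * k).1 * (ι₁ (θ.symm γ)).1 *
        (fibreTranslation V e * k).1⁻¹ = ι₂ γ := fun γ => by
      have h := congrArg Subtype.val (eq_mul_inv_of_mul_eq (he γ).symm)
      rw [← hval₂, h]
      change _ = (fibreTranslation V e).1 * (k.1 * (ι₁ (θ.symm γ)).1 * k.1⁻¹) *
        (fibreTranslation V e).1⁻¹
      simp [mul_assoc]
    refine h₁.affineBundleIso_of_conj h₂ (fibreTranslation V e * k) (fun γ => ⟨fun hγ => ?_,
      fun hγ => ?_⟩) φ hφ fun v => ?_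
    · have h := hconj (θ (ι₁.symm ⟨γ, hγ⟩))
      rw [θ.symm_apply_apply, ι₁.apply_symm_apply] at h
      rw [h]
      exact (ι₂ _).2
    · have h := hconj (ι₂.symm ⟨_, hγ⟩)
      rw [ι₂.apply_symm_apply] at h
      rw [← mul_left_cancel (mul_right_cancel h)]
      exact (ι₁ _).2
    · rw [← hφk]
      change q ((fibreTranslation V e).1 (k.1 (v, 0))).1 = q (k.1 (v, 0)).1
      rw [fibreTranslation_apply]
  tfae_finish
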